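/- Let $n\ge 1$ items $1,\dots,n$ have real values $x_1,\dots,x_n$, with maximum $x^*=\max_i x_i$. A query compares two distinct items $i,j$ and returns one of them; if $|x_i-x_j|>1$ it returns the item with the larger value, and otherwise the answer is chosen by an adversary. The adversary is adaptive: its answer may depend arbitrarily on $x_1,\dots,x_n$, on the algorithm, and on all previous queries and their answers. Two subroutines act on a nonempty set $X$ of items. - $\mathrm{QS}(X)$: draw a pivot $p\in X$ uniformly at random, compare $p$ with every other item of $X$, and return the set of items that beat $p$; if there is none, return $\{p\}$. - $\mathrm{KO}(X)$: pair the items of $X$ uniformly at random (if $|X|$ is odd, one item stays unpaired and has no win), compare the items of every pair, and return the set of winners. For $0<\varepsilon<\tfrac12$ the algorithm $A^{\mathrm{comb}}$ starts with $X=\{1,\dots,n\}$ and executes rounds $i=1,2,\dots$ as long as $|X|>1$. In round $i$, let $n_i=|X|$ be the size at the start of the round. First replace $X$ by $\mathrm{QS}(X)$, $\lfloor 9\log_2\frac1\varepsilon\rfloor$ times in succession. If then $|X|>\frac23 n_i$, run $\mathrm{KO}$ on this fixed set $X$ $t_i=\lfloor 25(\frac43)^i\log_2\frac1\varepsilon\rfloor$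 times, and replace $X$ by the set of items with more than $\frac34 t_i$ wins; if there is no such item, replace $X$ by a single item of $X$ with the highest number of wins. When $|X|=1$, output the remaining item. Theorem. (1) There is an absolute constant $K>0$ such that for all $n\ge1$, all $0<\varepsilon<\frac12$, all values $x_1,\dots,x_n$ and every adaptive adversary, the number of queries made by $A^{\mathrm{comb}}$ is at most $K\,n\log_2\frac1\varepsilon$ in every execution. In particular the maximum over all inputs and all adaptive adversaries of the expected number of queries is at most $K\,n\log_2\frac1\varepsilon$. (2) For all $n\ge 1$ and all $0<\varepsilon<\frac12$, the supremum over all inputs and all adaptive adversaries of the probability that the output item has value less than $x^*-2$ is smaller than $\varepsilon$. That is, with probability greater than $1-\varepsilon$ the output is a $2$-approximation of the maximum. -/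

import Mathlib

open scoped ENNReal

/-- A randomized algorithm that accesses a pairwise comparator on the index set `ι` and returns a
value in `α`: it stops with an output, or queries the comparator on two indices and continues
according to the index that is returned, or draws a random value with a given law and continues
according to that value. The algorithm sees nothing else (in particular not the values of the
inputs). -/
inductive QueryAlg (ι : Type) (α : Type) : Type 1
  | done (a : α) : QueryAlg ι α
  | query (i j : ι) (k : ι → QueryAlg ι α) : QueryAlg ι α
  | rand {β : Type} (p : PMF β) (k : β → QueryAlg ι α) : QueryAlg ι α

/-- The past queries together with their outcomes, most recent first: the entry `(i, j, w)` says
that `i` and `j` were compared and that `w` was declared the winner. -/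
abbrev History (ι : Type) : Type := List (ι × ι × ι)

/-- An adaptive adversarial comparator (with threshold `1`) for the inputs with values `x`: the
outcome of a query may depend on all previous queries and outcomes (and on `x`); it is one of the two
compared indices, and it is the index of the larger value if the values differ by more than `1`. -/
structure AdaptiveComparator {ι : Type} (x : ι → ℝ) where
  answer : History ι → ι → ι → ι
  answer_eq_or : ∀ h i j, answer h i j = i ∨ answer h i j = j
  answer_of_lt : ∀ h i j, 1 < |x i - x j| → answer h i j = if x j < x i then i else j

namespace QueryAlg

variable {ι α β : Type}

/-- Sequential composition of algorithms. -/
protected def bind : QueryAlg ι α → (α → QueryAlg ι β) → QueryAlg ι β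
  | done a, f => f a
  | query i j k, f => query i j fun w => (k w).bind f
  | rand p k, f => rand p fun b => (k b).bind f

instance : Monad (QueryAlg ι) where
  pure := done
  bind := QueryAlg.bind

/-- A random draw, as an algorithm that makes no query. -/
def draw (p : PMF α) : QueryAlg ι α := rand p done

/-- The joint law of the output and of the complete history when the algorithm is run against the
comparator `C`, where `h` is the history so far. -/
noncomputable def run {x : ι → ℝ} (C : AdaptiveComparator x) :
    QueryAlg ι α → History ι → PMF (α × History ι)
  | done a, h => PMF.pure (a, h)
  | query i j k, h => (k (C.answer h i j)).run C ((i, j, C.answer h i j) :: h)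
  | rand p k, h => p.bind fun b => (k b).run C h

/-- The expected number of queries against the comparator `C`. -/
noncomputable def expectedQueries {x : ι → ℝ} (A : QueryAlg ι α) (C : AdaptiveComparator x) :
    ℝ≥0∞ :=
  ∑' r : α × History ι, A.run C [] r * (r.2.length : ℝ≥0∞)

/-- The maximum expected query complexity over all inputs and all adaptive adversarial
comparators. -/
noncomputable def maxExpectedQueries (A : QueryAlg ι α) : ℝ≥0∞ :=
  ⨆ (x : ι → ℝ) (C : AdaptiveComparator x), A.expectedQueries C

/-- The `t`-approximation error against `C`: the probability that the value of the output index is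
smaller than the maximum value minus `t`. -/
noncomputable def approxError [Fintype ι] [Nonempty ι] {x : ι → ℝ} (A : QueryAlg ι ι)
    (C : AdaptiveComparator x) (t : ℝ) : ℝ≥0∞ :=
  (A.run C []).toOuterMeasure
    {r | x r.1 < Finset.univ.sup' Finset.univ_nonempty x - t}

/-- The maximum `t`-approximation error over all inputs and all adaptive adversarial
comparators. -/
noncomputable def maxApproxError [Fintype ι] [Nonempty ι] (A : QueryAlg ι ι) (t : ℝ) : ℝ≥0∞ :=
  ⨆ (x : ι → ℝ) (C : AdaptiveComparator x), A.approxError C t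

end QueryAlg

section Algorithm

variable {ι : Type} [DecidableEq ι]

/-- Query the listed pairs one after the other; the output is the list of the winners. -/
def playAll : List (ι × ι) → QueryAlg ι (List ι)
  | [] => pure []
  | (i, j) :: l => QueryAlg.query i j fun w => do
      let ws ← playAll l
      pure (w :: ws)

/-- The sets that can remain of the nonempty set `X` of indices after one reduction step: nonempty
subsets, proper ones unless `X` is a single index. -/
abbrev Remaining (X : Finset ι) : Type :=
  {Y : Finset ι // Y.Nonempty ∧ Y ⊆ X ∧ (1 < X.card → Y.card < X.card)}

/-- Quick-select subroutine: draw a pivot of `X` uniformly at random, compare it with all other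
elements of `X`, and keep the elements that beat the pivot, or the pivot if there are none. -/
noncomputable def qsSub (X : Finset ι) (hX : X.Nonempty) : QueryAlg ι (Remaining X) :=
  haveI : Nonempty X := hX.to_subtype
  do
    let p ← QueryAlg.draw (PMF.uniformOfFintype X)
    let ws ← playAll ((X.erase p.1).toList.map fun j => (p.1, j))
    let Y := (X.erase p.1).filter fun j => j ∈ ws
    if hY : Y.Nonempty then
      pure ⟨Y, hY, (Finset.filter_subset _ _).trans (Finset.erase_subset _ _), fun _ =>
        (Finset.card_le_card (Finset.filter_subset _ _)).trans_lt
          (Finset.card_erase_lt_of_mem p.2)⟩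
    else
      pure ⟨{p.1}, Finset.singleton_nonempty _, Finset.singleton_subset_iff.2 p.2, fun h => by
        simpa using h⟩

/-- Replace `X` by the output of the quick-select subroutine, `m` times. -/
noncomputable def qsRepeat : (m : ℕ) → (X : Finset ι) → X.Nonempty →
    QueryAlg ι {Y : Finset ι // Y.Nonempty ∧ Y ⊆ X ∧ (0 < m → 1 < X.card → Y.card < X.card)}
  | 0, X, hX => pure ⟨X, hX, subset_rfl, fun h => absurd h (lt_irrefl 0)⟩
  | m + 1, X, hX => do
      let Y ← qsSub X hX
      let Z ← qsRepeat m Y.1 Y.2.1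
      pure ⟨Z.1, Z.2.1, Z.2.2.1.trans Y.2.2.1, fun _ h =>
        (Finset.card_le_card Z.2.2.1).trans_lt (Y.2.2.2 h)⟩

/-- Knock-out subroutine: pair the elements of `X` uniformly at random (first with second, third
with fourth, and so on in a uniformly random order; if the number of elements is odd, then one of
them is not paired, makes no query and has no win), compare the pairs, and return the winners. -/
noncomputable def koSub (X : Finset ι) : QueryAlg ι (Finset ι) :=
  haveI : Nonempty (Fin X.card ≃ X) := ⟨X.equivFin.symm⟩
  do
    let e ← QueryAlg.draw (PMF.uniformOfFintype (Fin X.card ≃ X))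
    let ws ← playAll (List.ofFn fun k : Fin (X.card / 2) =>
      ((e ⟨2 * k.1, by omega⟩).1, (e ⟨2 * k.1 + 1, by omega⟩).1))
    pure ws.toFinset

/-- Run the knock-out subroutine `t` times on the fixed set `X`; the output is the number of wins
of each index. -/
noncomputable def koRepeat (X : Finset ι) : ℕ → QueryAlg ι (ι → ℕ)
  | 0 => pure fun _ => 0
  | t + 1 => do
      let c ← koRepeat X t
      let W ← koSub X
      pure fun i => c i + if i ∈ W then 1 else 0

/-- The number of quick-select calls per round, `⌊9 log₂ (1/ε)⌋`. -/
noncomputable def qsCalls (ε : ℝ) : ℕ := ⌊9 * Real.logb 2 (1 / ε)⌋₊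

/-- The number of knock-out calls in round `i`, `⌊25 (4/3)^i log₂ (1/ε)⌋`. -/
noncomputable def koCalls (ε : ℝ) (i : ℕ) : ℕ := ⌊25 * (4 / 3 : ℝ) ^ i * Real.logb 2 (1 / ε)⌋₊

theorem qsCalls_pos {ε : ℝ} (h0 : 0 < ε) (h1 : ε < 1 / 2) : 0 < qsCalls ε := by
  have h : (1 : ℝ) ≤ Real.logb 2 (1 / ε) := by
    rw [Real.le_logb_iff_rpow_le (by norm_num) (by positivity), Real.rpow_one,
      le_div_iff₀ h0]
    linarith
  exact Nat.floor_pos.2 (by linarith)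

/-- Round `i` of the combined algorithm, started with the set `X` of more than one index. -/
noncomputable def combRound (ε : ℝ) (h0 : 0 < ε) (h1 : ε < 1 / 2) (i : ℕ) (X : Finset ι)
    (hX : 1 < X.card) : QueryAlg ι {Y : Finset ι // Y.Nonempty ∧ Y.card < X.card} := do
  let Y ← qsRepeat (qsCalls ε) X (Finset.card_pos.1 (zero_lt_one.trans hX))
  have hYX : Y.1.card < X.card := Y.2.2.2 (qsCalls_pos h0 h1) hX
  if (2 / 3 : ℝ) * X.card < Y.1.card then do
    let wins ← koRepeat Y.1 (koCalls ε i)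
    let Z := Y.1.filter fun j => (3 / 4 : ℝ) * koCalls ε i < wins j
    if hZ : Z.Nonempty then
      pure ⟨Z, hZ, (Finset.card_le_card (Finset.filter_subset _ _)).trans_lt hYX⟩
    else
      pure ⟨{(Y.1.exists_max_image wins Y.2.1).choose}, Finset.singleton_nonempty _, by
        simpa using hX⟩
  else
    pure ⟨Y.1, Y.2.1, hYX⟩

/-- The loop of the combined algorithm from round `i` on: as long as `X` has more than one element,
execute a round. The output is the remaining index. -/
noncomputable def combLoop (ε : ℝ) (h0 : 0 < ε) (h1 : ε < 1 / 2) (i : ℕ) (X : Finset ι)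
    (hX : X.Nonempty) : QueryAlg ι ι :=
  if h : 1 < X.card then do
    let Y ← combRound ε h0 h1 i X h
    combLoop ε h0 h1 (i + 1) Y.1 Y.2.1
  else
    pure hX.choose
termination_by X.card
decreasing_by exact Y.2.2

/-- The knock-out and quick-select combination on `n` inputs with error parameter `ε`; the rounds
are numbered from `1`. -/
noncomputable def combAlg (n : ℕ) [NeZero n] (ε : ℝ) (h0 : 0 < ε) (h1 : ε < 1 / 2) :
    QueryAlg (Fin n) (Fin n) :=
  combLoop ε h0 h1 1 Finset.univ Finset.univ_nonempty

end Algorithm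

/-! Queries. Every round shrinks the set by a factor of at least 3/2. Either quick-select already
does so, or knock-out does: `t` knock-outs on `Y` produce at most `t|Y|/2` wins, so fewer than
`2|Y|/3` items, roughly speaking, can have more than `3t/4` of them. The dominant cost of round `i`
then decays like `(4/3)^i (2/3)^i = (8/9)^i`, and the total is linear in `n log₂ (1/ε)`.

Error. Let `a` be an item of maximal value, and call an item close if its value is at least `x a -
1`. A close pivot leaves only items of value at least `x a - 2`, and this persists in all later
subsets; any other pivot loses to `a`. So each quick-select call either succeeds for good or keeps
`a`. If `s` close items are left at the end of the `m` calls of a round started with `N` items,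
every earlier set had at least `s` of them, and this outcome carries a factor `(1 - s/N)^m`
(`qsRepeat_expect_le`). In a knock-out on `Y`, `a` can only fail when its partner is close or
missing, an event of probability at most `s/|Y|`, and a Chernoff bound controls the number of wins
of `a`.

The errors of the rounds are not summed. The single bound `W = (19/21)^m` is an invariant: if it
holds for every later set containing `a`, it holds before the round (`round_error_le`,
`combRound_expect_le`). Many close items make quick-select succeed; few make knock-out safe, and the
gain in quick-select pays for the risk. Finally `W < ε` (`pow_qsCalls_lt`). -/

namespace QueryAlg

/-! ### Expectations and sure properties of runs -/

variable {ι α β : Type}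

/-- The expectation of `g` at the output and the final history of a run with initial history `h`. -/
noncomputable def expect {x : ι → ℝ} (C : AdaptiveComparator x) :
    QueryAlg ι α → (α → History ι → ℝ≥0∞) → History ι → ℝ≥0∞
  | done a, g, h => g a h
  | query i j k, g, h => expect C (k (C.answer h i j)) g ((i, j, C.answer h i j) :: h)
  | rand p k, g, h => ∑' b, p b * expect C (k b) g h

/-- Every possible run with initial history `h` satisfies `P`. -/
def Always {x : ι → ℝ} (C : AdaptiveComparator x) :
    QueryAlg ι α → (α → History ι → Prop) → History ι → Prop
  | done a, P, h => P a h
  | query i j k, P, h => Always C (k (C.answer h i j)) P ((i, j, C.answer h i j) :: h)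
  | rand p k, P, h => ∀ b ∈ p.support, Always C (k b) P h

variable {x : ι → ℝ} {C : AdaptiveComparator x}

/-- Passes from the law of a run to the recursive expectation. The latter is indexed by the initial
history, so bounds valid for all histories are conditional bounds against an adaptive adversary and
compose along `bind`. -/
theorem tsum_run_mul (A : QueryAlg ι α) (g : α → History ι → ℝ≥0∞) (h : History ι) :
    ∑' r, A.run C h r * g r.1 r.2 = A.expect C g h := by
  induction A generalizing h with
  | done a =>
    rw [tsum_eq_single (a, h)]
    · simp [run, expect]
    · intro r hr
      simp [run, hr]
  | query i j k ih => exact ih _ _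
  | rand p k ih =>
    simp only [run, expect, PMF.bind_apply, ← ih, ← ENNReal.tsum_mul_right, ← ENNReal.tsum_mul_left]
    rw [ENNReal.tsum_comm]
    simp only [mul_assoc]

@[simp] theorem expect_pure (a : α) (g : α → History ι → ℝ≥0∞) (h : History ι) :
    (pure a : QueryAlg ι α).expect C g h = g a h := rfl

@[simp] theorem expect_draw (p : PMF α) (g : α → History ι → ℝ≥0∞) (h : History ι) :
    (draw p).expect C g h = ∑' b, p b * g b h := rfl

@[simp] theorem expect_bind (A : QueryAlg ι α) (f : α → QueryAlg ι β)
    (g : β → History ι → ℝ≥0∞) (h : History ι) :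
    (A >>= f).expect C g h = A.expect C (fun a h' => (f a).expect C g h') h := by
  change (A.bind f).expect C g h = _
  induction A generalizing h with
  | done a => rfl
  | query i j k ih => exact ih _ _
  | rand p k ih => simp only [QueryAlg.bind, expect, ih]

@[simp] theorem always_pure (a : α) (P : α → History ι → Prop) (h : History ι) :
    (pure a : QueryAlg ι α).Always C P h ↔ P a h := Iff.rfl

@[simp] theorem always_query (i j : ι) (k : ι → QueryAlg ι α) (P : α → History ι → Prop)
    (h : History ι) : (query i j k).Always C P h ↔
      (k (C.answer h i j)).Always C P ((i, j, C.answer h i j) :: h) := Iff.rfl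

@[simp] theorem always_draw (p : PMF α) (P : α → History ι → Prop) (h : History ι) :
    (draw p).Always C P h ↔ ∀ b ∈ p.support, P b h := Iff.rfl

@[simp] theorem always_bind (A : QueryAlg ι α) (f : α → QueryAlg ι β)
    (P : β → History ι → Prop) (h : History ι) :
    (A >>= f).Always C P h ↔ A.Always C (fun a h' => (f a).Always C P h') h := by
  change (A.bind f).Always C P h ↔ _
  induction A generalizing h with
  | done a => exact Iff.rfl
  | query i j k ih => exact ih _ _
  | rand p k ih => simp only [QueryAlg.bind, Always, ih]

theorem Always.mono {A : QueryAlg ι α} {P Q : α → History ι → Prop} {h : History ι}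
    (hA : A.Always C P h) (hPQ : ∀ a h', P a h' → Q a h') : A.Always C Q h := by
  induction A generalizing h with
  | done a => exact hPQ _ _ hA
  | query i j k ih => exact ih _ hA
  | rand p k ih => exact fun b hb => ih b (hA b hb)

theorem always_of_forall (A : QueryAlg ι α) {P : α → History ι → Prop} (h : History ι)
    (hP : ∀ a h', P a h') : A.Always C P h := by
  induction A generalizing h with
  | done a => exact hP _ _
  | query i j k ih => exact ih _ _
  | rand p k ih => exact fun b _ => ih b h

theorem Always.of_mem_support {A : QueryAlg ι α} {P : α → History ι → Prop} {h : History ι}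
    (hA : A.Always C P h) {r : α × History ι} (hr : r ∈ (A.run C h).support) : P r.1 r.2 := by
  induction A generalizing h with
  | done a =>
    have : r = (a, h) := by simpa [run] using hr
    subst this
    exact hA
  | query i j k ih => exact ih _ hA hr
  | rand p k ih =>
    rw [run, PMF.mem_support_bind_iff] at hr
    obtain ⟨b, hb, hr⟩ := hr
    exact ih b (hA b hb) hr

theorem Always.expect_le_expect {A : QueryAlg ι α} {P : α → History ι → Prop} {h : History ι}
    (hA : A.Always C P h) {g g' : α → History ι → ℝ≥0∞}
    (hg : ∀ a h', P a h' → g a h' ≤ g' a h') : A.expect C g h ≤ A.expect C g' h := by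
  induction A generalizing h with
  | done a => exact hg _ _ hA
  | query i j k ih => exact ih _ hA
  | rand p k ih =>
    refine ENNReal.tsum_le_tsum fun b => ?_
    by_cases hb : p b = 0
    · simp [hb]
    · exact mul_le_mul_right (ih b (hA b ((p.mem_support_iff b).2 hb))) _

theorem expect_mono (A : QueryAlg ι α) {g g' : α → History ι → ℝ≥0∞}
    (hg : ∀ a h', g a h' ≤ g' a h') (h : History ι) : A.expect C g h ≤ A.expect C g' h :=
  (A.always_of_forall (P := fun _ _ => True) h fun _ _ => trivial).expect_le_expect
    fun a h' _ => hg a h'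

@[simp] theorem expect_const (A : QueryAlg ι α) (c : ℝ≥0∞) (h : History ι) :
    A.expect C (fun _ _ => c) h = c := by
  induction A generalizing h with
  | done a => rfl
  | query i j k ih => exact ih _ _
  | rand p k ih => simp only [expect, ih, ENNReal.tsum_mul_right, p.tsum_coe, one_mul]

theorem expect_add (A : QueryAlg ι α) (g g' : α → History ι → ℝ≥0∞) (h : History ι) :
    A.expect C (fun a h' => g a h' + g' a h') h = A.expect C g h + A.expect C g' h := by
  simp only [← tsum_run_mul, mul_add, ENNReal.tsum_add]

theorem expect_mul_left (A : QueryAlg ι α) (c : ℝ≥0∞) (g : α → History ι → ℝ≥0∞)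
    (h : History ι) : A.expect C (fun a h' => c * g a h') h = c * A.expect C g h := by
  simp only [← tsum_run_mul, mul_left_comm _ c, ENNReal.tsum_mul_left]

theorem Always.expect_le {A : QueryAlg ι α} {P : α → History ι → Prop} {h : History ι}
    (hA : A.Always C P h) {g : α → History ι → ℝ≥0∞} {c : ℝ≥0∞}
    (hg : ∀ a h', P a h' → g a h' ≤ c) : A.expect C g h ≤ c :=
  (hA.expect_le_expect (g' := fun _ _ => c) hg).trans_eq (expect_const A c h)

theorem expect_le_of_forall (A : QueryAlg ι α) {g : α → History ι → ℝ≥0∞} {c : ℝ≥0∞}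
    (hg : ∀ a h', g a h' ≤ c) (h : History ι) : A.expect C g h ≤ c :=
  (expect_mono A hg h).trans_eq (expect_const A c h)

theorem approxError_eq_expect [Fintype ι] [Nonempty ι] (A : QueryAlg ι ι) (t : ℝ) :
    A.approxError C t = A.expect C (fun i _ =>
      if x i < Finset.univ.sup' Finset.univ_nonempty x - t then 1 else 0) [] := by
  rw [approxError, PMF.toOuterMeasure_apply, ← tsum_run_mul]
  refine tsum_congr fun r => ?_
  by_cases hr : x r.1 < Finset.univ.sup' Finset.univ_nonempty x - t <;>
    simp [Set.indicator, hr]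

end QueryAlg

/-! ### Worst-case number of queries -/

section QueryBounds

variable {ι : Type} {x : ι → ℝ} {C : AdaptiveComparator x}

open QueryAlg

/-- The item `w` is a possible answer to a query of the pair `p`. -/
def IsAnswer (x : ι → ℝ) (p : ι × ι) (w : ι) : Prop :=
  (w = p.1 ∨ w = p.2) ∧ (1 < |x p.1 - x p.2| → w = if x p.2 < x p.1 then p.1 else p.2)

/-- All that later arguments need about the adversary: each answer is admissible by itself, whatever
the history. -/
theorem playAll_always (l : List (ι × ι)) (h : History ι) :
    (playAll l).Always C
      (fun ws h' => List.Forall₂ (IsAnswer x) l ws ∧ h'.length = h.length + l.length) h := by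
  induction l generalizing h with
  | nil => simp [playAll]
  | cons p l ih =>
    obtain ⟨i, j⟩ := p
    rw [playAll, always_query, always_bind]
    refine (ih _).mono fun ws h' hw => ?_
    rw [always_pure, List.forall₂_cons]
    refine ⟨⟨⟨C.answer_eq_or h i j, C.answer_of_lt h i j⟩, hw.1⟩, ?_⟩
    rw [hw.2, List.length_cons, List.length_cons]
    ring

variable [DecidableEq ι]

theorem qsSub_always_length (X : Finset ι) (hX : X.Nonempty) (h : History ι) :
    (qsSub X hX).Always C (fun _ h' => h'.length ≤ h.length + X.card) h := by
  rw [qsSub, always_bind, always_draw]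
  intro p _
  rw [always_bind]
  refine (playAll_always _ h).mono fun ws h' hw => ?_
  have hl : h'.length ≤ h.length + X.card := by
    rw [hw.2, List.length_map, Finset.length_toList]
    exact Nat.add_le_add_left (Finset.card_le_card (Finset.erase_subset _ _)) _
  dsimp only
  split_ifs <;> exact hl

theorem qsRepeat_always_length (m : ℕ) (X : Finset ι) (hX : X.Nonempty) (h : History ι) :
    (qsRepeat m X hX).Always C (fun _ h' => h'.length ≤ h.length + m * X.card) h := by
  induction m generalizing X h with
  | zero => simp [qsRepeat]
  | succ m ih =>
    rw [qsRepeat, always_bind]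
    refine (qsSub_always_length X hX h).mono fun Y h₁ hY => ?_
    rw [always_bind]
    refine (ih Y.1 Y.2.1 h₁).mono fun Z h₂ hZ => ?_
    rw [always_pure]
    have := Nat.mul_le_mul_left m (Finset.card_le_card Y.2.2.1)
    linarith

theorem koSub_always_card (X : Finset ι) (h : History ι) :
    (koSub X).Always C
      (fun W h' => W.card ≤ X.card / 2 ∧ h'.length = h.length + X.card / 2) h := by
  rw [koSub, always_bind, always_draw]
  intro e _
  rw [always_bind]
  refine (playAll_always _ h).mono fun ws h' hw => ?_
  have hl := hw.1.length_eq
  have hh := hw.2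
  rw [List.length_ofFn] at hl hh
  exact ⟨(List.toFinset_card_le ws).trans_eq hl.symm, hh⟩

theorem koRepeat_always_sum (X : Finset ι) (t : ℕ) (h : History ι) :
    (koRepeat X t).Always C (fun c h' => ∑ j ∈ X, c j ≤ t * (X.card / 2) ∧
      h'.length = h.length + t * (X.card / 2)) h := by
  induction t with
  | zero => simp [koRepeat]
  | succ t ih =>
    rw [koRepeat, always_bind]
    refine ih.mono fun c h₁ hc => ?_
    rw [always_bind]
    refine (koSub_always_card X h₁).mono fun W h₂ hW => ?_
    rw [always_pure]
    constructor
    · rw [Finset.sum_add_distrib, add_mul, one_mul]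
      refine Nat.add_le_add hc.1 (le_trans ?_ hW.1)
      rw [← Finset.sum_filter, Finset.sum_const, smul_eq_mul, mul_one]
      exact Finset.card_le_card fun j hj => (Finset.mem_filter.1 hj).2
    · rw [hW.2, hc.2]
      ring

theorem one_lt_logb_two_inv {ε : ℝ} (h0 : 0 < ε) (h1 : ε < 1 / 2) :
    1 < Real.logb 2 (1 / ε) := by
  rw [Real.lt_logb_iff_rpow_lt (by norm_num) (by positivity), Real.rpow_one, lt_div_iff₀ h0]
  linarith

/-- Since `i ≥ 1`, the factor `25 · 4/3` exceeds `27 = 3 · 9`. The Chernoff estimate in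
`round_error_le` needs this ratio of 3. -/
theorem three_mul_qsCalls_le_koCalls {ε : ℝ} (h0 : 0 < ε) (h1 : ε < 1 / 2) {i : ℕ}
    (hi : 1 ≤ i) : 3 * qsCalls ε ≤ koCalls ε i := by
  have hL := one_lt_logb_two_inv h0 h1
  refine Nat.le_floor ?_
  have h9 : (qsCalls ε : ℝ) ≤ 9 * Real.logb 2 (1 / ε) := Nat.floor_le (by linarith)
  have h43 : (4 / 3 : ℝ) ≤ (4 / 3 : ℝ) ^ i := by
    simpa using pow_le_pow_right₀ (by norm_num : (1 : ℝ) ≤ 4 / 3) hi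
  push_cast
  nlinarith

theorem combRound_always_subset (ε : ℝ) (h0 : 0 < ε) (h1 : ε < 1 / 2) (i : ℕ) (X : Finset ι)
    (hX : 1 < X.card) (h : History ι) :
    (combRound ε h0 h1 i X hX).Always C (fun Y _ => Y.1 ⊆ X) h := by
  rw [combRound, always_bind]
  refine always_of_forall _ _ fun Y h₁ => ?_
  dsimp only
  split_ifs with hc
  · rw [always_bind]
    refine always_of_forall _ _ fun c h₂ => ?_
    split_ifs with hZ
    · exact (Finset.filter_subset _ _).trans Y.2.2.1
    · exact Finset.singleton_subset_iff.2
        (Y.2.2.1 (Y.1.exists_max_image c Y.2.1).choose_spec.1)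
  · exact Y.2.2.1

theorem combRound_always_card (ε : ℝ) (h0 : 0 < ε) (h1 : ε < 1 / 2) (i : ℕ) (hi : 1 ≤ i)
    (X : Finset ι) (hX : 1 < X.card) (h : History ι) :
    (combRound ε h0 h1 i X hX).Always C (fun Y h' => (Y.1.card : ℝ) ≤ 2 / 3 * X.card ∧
      (h'.length : ℝ) ≤ h.length +
        (9 + 25 / 2 * (4 / 3 : ℝ) ^ i) * X.card * Real.logb 2 (1 / ε)) h := by
  have hL := one_lt_logb_two_inv h0 h1
  set L := Real.logb 2 (1 / ε) with hLdef
  have hm : (qsCalls ε : ℝ) ≤ 9 * L := Nat.floor_le (by linarith)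
  have ht : (koCalls ε i : ℝ) ≤ 25 * (4 / 3 : ℝ) ^ i * L := Nat.floor_le (by positivity)
  have ht0 : (0 : ℝ) < koCalls ε i := by
    exact_mod_cast (Nat.mul_pos three_pos (qsCalls_pos h0 h1)).trans_le
      (three_mul_qsCalls_le_koCalls h0 h1 hi)
  have hX2 : (2 : ℝ) ≤ X.card := by exact_mod_cast hX
  rw [combRound, always_bind]
  refine (qsRepeat_always_length _ _ _ h).mono fun Y h₁ hY => ?_
  have hYX : (Y.1.card : ℝ) ≤ X.card := by exact_mod_cast Finset.card_le_card Y.2.2.1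
  have hqs : (h₁.length : ℝ) ≤ h.length + 9 * X.card * L := by
    have : (h₁.length : ℝ) ≤ h.length + qsCalls ε * X.card := by exact_mod_cast hY
    nlinarith
  dsimp only
  split_ifs with hc
  · rw [always_bind]
    refine (koRepeat_always_sum Y.1 _ h₁).mono fun c h₂ hc₂ => ?_
    have hhalf : ((Y.1.card / 2 : ℕ) : ℝ) ≤ Y.1.card / 2 := Nat.cast_div_le
    have hlen : (h₂.length : ℝ) ≤ h.length +
        (9 + 25 / 2 * (4 / 3 : ℝ) ^ i) * X.card * L := by
      have e : (h₂.length : ℝ) = h₁.length + koCalls ε i * ((Y.1.card / 2 : ℕ) : ℝ) := by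
        exact_mod_cast hc₂.2
      have : (koCalls ε i : ℝ) * ((Y.1.card / 2 : ℕ) : ℝ) ≤
          25 * (4 / 3 : ℝ) ^ i * L * (X.card / 2) := by
        gcongr
        linarith
      linarith
    split_ifs with hZ
    · refine ⟨?_, hlen⟩
      set Z := Y.1.filter fun j => (3 / 4 : ℝ) * koCalls ε i < c j
      have hsum : (∑ j ∈ Y.1, (c j : ℝ)) ≤ koCalls ε i * ((Y.1.card / 2 : ℕ) : ℝ) := by
        exact_mod_cast hc₂.1
      have hZs : Z.card • ((3 / 4 : ℝ) * koCalls ε i) ≤ ∑ j ∈ Y.1, (c j : ℝ) :=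
        (Finset.card_nsmul_le_sum Z _ _ fun j hj => (Finset.mem_filter.1 hj).2.le).trans
          (Finset.sum_le_sum_of_subset_of_nonneg (Finset.filter_subset _ _)
            fun _ _ _ => Nat.cast_nonneg _)
      rw [nsmul_eq_mul] at hZs
      have hZY : (koCalls ε i : ℝ) * (Z.card * (3 / 4)) ≤ koCalls ε i * (X.card / 2) := by
        have : (koCalls ε i : ℝ) * ((Y.1.card / 2 : ℕ) : ℝ) ≤ koCalls ε i * (X.card / 2) := by
          gcongr
          linarith
        linarith
      change (Z.card : ℝ) ≤ _
      linarith [le_of_mul_le_mul_left hZY ht0]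
    · refine ⟨?_, hlen⟩
      simp only [Finset.card_singleton, Nat.cast_one]
      linarith
  · refine ⟨not_lt.1 hc, hqs.trans ?_⟩
    have : 0 ≤ 25 / 2 * (4 / 3 : ℝ) ^ i * X.card * L := by positivity
    linarith

/-- The coefficient solves the recursion given by the shrinking factor `2/3`: `27 · 2/3 + 9 = 27`
and `225/2 · 4/3 · 2/3 + 25/2 = 225/2`. At `i = 1` it equals 177. -/
theorem combLoop_always_length (ε : ℝ) (h0 : 0 < ε) (h1 : ε < 1 / 2) (i : ℕ) (hi : 1 ≤ i)
    (X : Finset ι) (hX : X.Nonempty) (h : History ι) :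
    (combLoop ε h0 h1 i X hX).Always C (fun _ h' => (h'.length : ℝ) ≤ h.length +
      (27 + 225 / 2 * (4 / 3 : ℝ) ^ i) * X.card * Real.logb 2 (1 / ε)) h := by
  have hL := one_lt_logb_two_inv h0 h1
  induction hc : X.card using Nat.strong_induction_on generalizing X i h with
  | _ N ih =>
    subst hc
    rw [combLoop]
    split_ifs with hX1
    · rw [always_bind]
      refine (combRound_always_card ε h0 h1 i hi X hX1 h).mono fun Y h₁ hY => ?_
      refine (ih _ Y.2.2 (i + 1) (by omega) Y.1 Y.2.1 h₁ rfl).mono fun r h₂ hr => hr.trans ?_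
      have hmul : (27 + 225 / 2 * (4 / 3 : ℝ) ^ (i + 1)) * Y.1.card * Real.logb 2 (1 / ε) ≤
          (27 + 225 / 2 * (4 / 3 : ℝ) ^ (i + 1)) * (2 / 3 * X.card) * Real.logb 2 (1 / ε) := by
        have := hY.1
        gcongr
      rw [pow_succ] at hmul ⊢
      linarith [hY.2]
    · rw [always_pure]
      have : 0 ≤ (27 + 225 / 2 * (4 / 3 : ℝ) ^ i) * X.card * Real.logb 2 (1 / ε) := by
        positivity
      linarith

theorem combAlg_always_length (n : ℕ) [NeZero n] (ε : ℝ) (h0 : 0 < ε) (h1 : ε < 1 / 2)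
    {x : Fin n → ℝ} (C : AdaptiveComparator x) :
    (combAlg n ε h0 h1).Always C
      (fun _ h' => (h'.length : ℝ) ≤ 177 * (n * Real.logb 2 (1 / ε))) [] := by
  refine (combLoop_always_length ε h0 h1 1 le_rfl _ _ []).mono fun _ h' h => h.trans_eq ?_
  rw [Finset.card_univ, Fintype.card_fin, List.length_nil]
  push_cast
  ring

end QueryBounds

/-! ### Partners in a uniformly random pairing -/

section Pairing

/-- When the positions below `c` are paired consecutively, `0` with `1`, `2` with `3`,
and so on, the partner of a position; the last position is its own partner if `c` is odd. -/
def partnerIdx {c : ℕ} (k : Fin c) : Fin c :=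
  if k.1 % 2 = 0 then (if h : k.1 + 1 < c then ⟨k.1 + 1, h⟩ else k)
  else ⟨k.1 - 1, (Nat.sub_le _ _).trans_lt k.2⟩

theorem partnerIdx_val {c : ℕ} (k : Fin c) : (partnerIdx k).1 =
    if k.1 % 2 = 0 then (if k.1 + 1 < c then k.1 + 1 else k.1) else k.1 - 1 := by
  unfold partnerIdx
  split_ifs <;> rfl

theorem partnerIdx_involutive (c : ℕ) : Function.Involutive (partnerIdx (c := c)) := by
  intro k
  have hk := k.2
  ext
  rw [partnerIdx_val, partnerIdx_val]
  split_ifs <;> omega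

theorem eq_of_partnerIdx_eq_self {c : ℕ} {k l : Fin c} (hk : partnerIdx k = k)
    (hl : partnerIdx l = l) : k = l := by
  have hkc := k.2
  have hlc := l.2
  have hk' := congrArg Fin.val hk
  have hl' := congrArg Fin.val hl
  rw [partnerIdx_val] at hk' hl'
  ext
  split_ifs at hk' hl' <;> omega

variable {κ α : Type*} [Fintype κ] [DecidableEq κ] [Fintype α] [DecidableEq α] {σ : κ → κ}

/-- If the items `α` are put in order by a uniformly random `e` and the positions are paired by an
involution `σ` with at most one fixed point, then no `b` is a more likely partner of `a` than any
`b' ≠ a`. -/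
theorem card_partner_le (hσ : Function.Involutive σ)
    (hfix : ∀ k l, σ k = k → σ l = l → k = l) (a b b' : α) (hb' : b' ≠ a) :
    (Finset.univ.filter fun e : κ ≃ α => e (σ (e.symm a)) = b).card ≤
      (Finset.univ.filter fun e : κ ≃ α => e (σ (e.symm a)) = b').card := by
  by_cases hb : b = a
  · subst hb
    -- Here `b = a` is unpaired. Moving it to the position opposite `b'` makes `b'` its partner; the
    -- move can be undone because the fixed point of `σ` is unique.
    refine Finset.card_le_card_of_injOn
      (fun e => (Equiv.swap (e.symm b) (σ (e.symm b'))).trans e) ?_ ?_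
    · intro e he
      have he' : σ (e.symm b) = e.symm b := by
        simpa [← Equiv.eq_symm_apply] using he
      have h1 : e.symm b' ≠ e.symm b := fun h => hb' (e.symm.injective h)
      have h2 : e.symm b' ≠ σ (e.symm b') := fun h => h1 (hfix _ _ h.symm he')
      have h3 : ((Equiv.swap (e.symm b) (σ (e.symm b'))).trans e).symm b = σ (e.symm b') := by
        simp
      simp only [Finset.coe_filter, Finset.mem_univ, true_and, Set.mem_ofPred_eq]
      rw [h3, hσ, Equiv.trans_apply, Equiv.swap_apply_of_ne_of_ne h1 h2, Equiv.apply_symm_apply]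
    · intro e he e' he' hee
      have hf : σ (e.symm b) = e.symm b := by
        simpa [← Equiv.eq_symm_apply] using he
      have hf' : σ (e'.symm b) = e'.symm b := by
        simpa [← Equiv.eq_symm_apply] using he'
      have h3 : ∀ e : κ ≃ α,
          ((Equiv.swap (e.symm b) (σ (e.symm b'))).trans e).symm b = σ (e.symm b') := by
        intro e
        simp
      have h1 := hfix _ _ hf hf'
      have h2 : σ (e.symm b') = σ (e'.symm b') := by
        rw [← h3 e, ← h3 e']
        exact congrArg (fun e : κ ≃ α => e.symm b) hee
      dsimp only at hee
      rw [← h1, ← h2] at hee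
      ext k
      have := congrArg (fun e : κ ≃ α => e (Equiv.swap (e'.symm b) (σ (e'.symm b')) k)) hee
      simpa [h1, h2] using this
  · refine Finset.card_le_card_of_injOn (fun e => e.trans (Equiv.swap b b')) ?_ ?_
    · intro e he
      have he' : e (σ (e.symm a)) = b := by simpa using he
      simp [Equiv.swap_apply_of_ne_of_ne (Ne.symm hb) (Ne.symm hb'), he']
    · intro e _ e' _ hee
      ext k
      have := congrArg (fun e : κ ≃ α => e k) hee
      simpa using this

/-- An averaging argument: each partner in `S` is at most as likely as each one outside `S`, so `S`
has at most its proportional share. Having `a ∈ S` counts the unpaired case as a partner in `S`. -/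
theorem card_partner_mem_mul_le (hσ : Function.Involutive σ)
    (hfix : ∀ k l, σ k = k → σ l = l → k = l) (a : α) (S : Finset α) (ha : a ∈ S) :
    (Finset.univ.filter fun e : κ ≃ α => e (σ (e.symm a)) ∈ S).card * Fintype.card α ≤
      S.card * Fintype.card (κ ≃ α) := by
  set N : α → ℕ := fun b => (Finset.univ.filter fun e : κ ≃ α => e (σ (e.symm a)) = b).card
    with hN
  have hS : (Finset.univ.filter fun e : κ ≃ α => e (σ (e.symm a)) ∈ S).card = ∑ b ∈ S, N b := by
    rw [Finset.card_eq_sum_card_fiberwise (f := fun e : κ ≃ α => e (σ (e.symm a))) (t := S)]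
    · refine Finset.sum_congr rfl fun b hb => ?_
      rw [Finset.filter_filter]
      congr 1
      ext e
      simp only [Finset.mem_filter, Finset.mem_univ, true_and, and_iff_right_iff_imp]
      rintro rfl
      exact hb
    · intro e he
      simpa using he
  have huniv : Fintype.card (κ ≃ α) = ∑ b, N b := by
    rw [← Finset.card_univ, Finset.card_eq_sum_card_fiberwise
      (f := fun e : κ ≃ α => e (σ (e.symm a))) (t := Finset.univ)]
    intro e _
    simp
  have hc : ∑ b ∈ S, N b * Fintype.card α = ∑ b ∈ S, ∑ _b' : α, N b := by
    simp [mul_comm]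
  rw [hS, huniv, Finset.sum_mul, hc, ← smul_eq_mul, ← Finset.sum_const]
  simp only [← Finset.sum_add_sum_compl S, Finset.sum_add_distrib]
  refine Nat.add_le_add Finset.sum_comm.le (Finset.sum_le_sum fun b _ =>
    Finset.sum_le_sum fun b' hb' => card_partner_le hσ hfix a b b' ?_)
  rintro rfl
  exact Finset.mem_compl.1 hb' ha

end Pairing

/-! ### Numerical estimates -/

section Numeric

/-- The error bound of a round in which the best item survives quick-select: `f` is the fraction of
items that are close to it at the start of the knock-out, and `p` bounds the probability that it
wins too few games. -/
theorem round_error_le {m t : ℕ} (hm : 1 ≤ m) (ht : 3 * m ≤ t) {f b p : ℝ} (hf0 : 0 ≤ f)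
    (hfb : 2 / 3 * f ≤ b) (hb1 : b ≤ 1) (hp1 : p ≤ 1)
    (hp : p * ((6 / 5) ^ t - 1) + 1 ≤ (1 + ((6 / 5) ^ 4 - 1) * f) ^ t) :
    ((19 / 21) ^ m + (1 - (19 / 21) ^ m) * p) * (1 - b) ^ m ≤ (19 / 21 : ℝ) ^ m := by
  have hW0 : (0 : ℝ) ≤ (19 / 21) ^ m := by positivity
  have hW1 : ((19 : ℝ) / 21) ^ m ≤ 1 := pow_le_one₀ (by norm_num) (by norm_num)
  have hWm : 1 - (19 / 21 : ℝ) ^ m ≤ 2 / 21 * m := by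
    have := one_add_mul_le_pow (a := (-2 / 21 : ℝ)) (by norm_num) m
    rw [show (1 : ℝ) + -2 / 21 = 19 / 21 by norm_num] at this
    linarith
  -- For `f ≥ 1/7`, `b ≥ 2/21` and quick-select alone gives `(19/21)^m`.
  by_cases hf : 1 / 7 ≤ f
  · have h1 : (1 - b) ^ m ≤ (19 / 21 : ℝ) ^ m :=
      pow_le_pow_left₀ (by linarith) (by linarith) m
    have h2 : (19 / 21 : ℝ) ^ m + (1 - (19 / 21) ^ m) * p ≤ 1 := by nlinarith
    calc _ ≤ 1 * (1 - b) ^ m := mul_le_mul_of_nonneg_right h2 (pow_nonneg (by linarith) m)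
      _ ≤ _ := by rwa [one_mul]
  · rw [not_le] at hf
    have hyt : (1 : ℝ) < (6 / 5) ^ t := one_lt_pow₀ (by norm_num) (by omega)
    -- Convexity between `0` and `1/7` keeps a factor `f` in the bound on `p`, which a plain
    -- Chernoff bound at `1/7` would lose.
    have hconv : (1 + ((6 / 5) ^ 4 - 1) * f) ^ t ≤
        (1 - 7 * f) * 1 ^ t + 7 * f * (1 + ((6 / 5 : ℝ) ^ 4 - 1) / 7) ^ t := by
      have hx : (1 : ℝ) ∈ Set.Ici (0 : ℝ) := by simp
      have hy : 1 + ((6 / 5 : ℝ) ^ 4 - 1) / 7 ∈ Set.Ici (0 : ℝ) := by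
        rw [Set.mem_Ici]
        norm_num
      have := (convexOn_pow t).2 hx hy (by linarith : 0 ≤ 1 - 7 * f) (by linarith : 0 ≤ 7 * f)
        (by ring)
      simp only [smul_eq_mul] at this
      refine le_trans (le_of_eq ?_) this
      congr 1
      ring
    have hchern : (1 + ((6 / 5 : ℝ) ^ 4 - 1) / 7) ^ t ≤ (19 / 21) ^ m * (6 / 5) ^ t := by
      have h1 : (1 + ((6 / 5 : ℝ) ^ 4 - 1) / 7) ^ t ≤ (0.9615 * (6 / 5)) ^ t :=
        pow_le_pow_left₀ (by norm_num) (by norm_num) t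
      have h2 : (0.9615 : ℝ) ^ t ≤ (0.9615 ^ 3) ^ m := by
        rw [← pow_mul]
        exact pow_le_pow_of_le_one (by norm_num) (by norm_num) ht
      have h3 : ((0.9615 : ℝ) ^ 3) ^ m ≤ (19 / 21) ^ m :=
        pow_le_pow_left₀ (by norm_num) (by norm_num) m
      rw [mul_pow] at h1
      exact h1.trans (mul_le_mul_of_nonneg_right (h2.trans h3) (by positivity))
    have hpf : p ≤ 7 * f * (19 / 21) ^ m := by
      refine le_of_mul_le_mul_right ?_ (sub_pos.2 hyt)
      rw [one_pow] at hconv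
      have : 7 * f * (1 + ((6 / 5 : ℝ) ^ 4 - 1) / 7) ^ t ≤
          7 * f * ((19 / 21) ^ m * (6 / 5) ^ t) :=
        mul_le_mul_of_nonneg_left hchern (by linarith)
      nlinarith
    have hb0 : 0 ≤ b := le_trans (by linarith) hfb
    -- Bernoulli twice: `1 - (19/21)^m ≤ 2m/21` turns `7f` into `2mf/3 ≤ mb`, and the resulting `(1
    -- + b)^m` is absorbed by `(1 - b)^m`.
    have hbern : 1 + (1 - (19 / 21 : ℝ) ^ m) * (7 * f) ≤ (1 + b) ^ m := by
      refine le_trans ?_ (one_add_mul_le_pow (by linarith) m)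
      have h1 : (1 - (19 / 21 : ℝ) ^ m) * (7 * f) ≤ 2 / 21 * m * (7 * f) :=
        mul_le_mul_of_nonneg_right hWm (by linarith)
      have h2 : (m : ℝ) * (2 / 3 * f) ≤ m * b :=
        mul_le_mul_of_nonneg_left hfb (Nat.cast_nonneg m)
      linarith
    calc _ ≤ (19 / 21 : ℝ) ^ m * (1 + (1 - (19 / 21) ^ m) * (7 * f)) * (1 - b) ^ m := by
          refine mul_le_mul_of_nonneg_right ?_ (pow_nonneg (by linarith) m)
          have := mul_le_mul_of_nonneg_left hpf (sub_nonneg.2 hW1)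
          linarith
      _ ≤ (19 / 21 : ℝ) ^ m * (1 + b) ^ m * (1 - b) ^ m :=
          mul_le_mul_of_nonneg_right (mul_le_mul_of_nonneg_left hbern hW0)
            (pow_nonneg (by linarith) m)
      _ = (19 / 21 : ℝ) ^ m * (1 - b ^ 2) ^ m := by
          rw [mul_assoc, ← mul_pow]
          ring
      _ ≤ (19 / 21 : ℝ) ^ m * 1 :=
          mul_le_mul_of_nonneg_left (pow_le_one₀ (by nlinarith) (by nlinarith)) hW0
      _ = _ := mul_one _

theorem pow_qsCalls_lt {ε : ℝ} (h0 : 0 < ε) (h1 : ε < 1 / 2) :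
    (19 / 21 : ℝ) ^ qsCalls ε < ε := by
  have hL := one_lt_logb_two_inv h0 h1
  set L := Real.logb 2 (1 / ε) with hLdef
  set m := qsCalls ε with hmdef
  have hm9 : 9 ≤ m := Nat.le_floor (by push_cast; linarith)
  have hmL : 9 * L < m + 1 := Nat.lt_floor_add_one _
  have hεL : (2 : ℝ) ^ L = 1 / ε := Real.rpow_logb (by norm_num) (by norm_num) (by positivity)
  have hpow : (1 / ε) ^ 9 < (2 : ℝ) ^ (m + 1) := by
    rw [← hεL, ← Real.rpow_natCast, ← Real.rpow_mul (by norm_num), ← Real.rpow_natCast]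
    refine Real.rpow_lt_rpow_of_exponent_lt (by norm_num) ?_
    push_cast
    linarith
  -- The extra factor 2 from rounding down is absorbed by `(6/5)^m`, as `m ≥ 9`; what remains is
  -- `12/5 ≤ (21/19)^9`.
  have h2 : (2 : ℝ) ^ (m + 1) ≤ ((21 / 19) ^ m) ^ 9 := by
    have h3 : (2 : ℝ) ≤ (6 / 5) ^ m :=
      le_trans (by norm_num) (pow_le_pow_right₀ (by norm_num : (1 : ℝ) ≤ 6 / 5) hm9)
    calc (2 : ℝ) ^ (m + 1) = 2 ^ m * 2 := pow_succ _ _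
      _ ≤ 2 ^ m * (6 / 5) ^ m := by gcongr
      _ = (12 / 5) ^ m := by rw [← mul_pow]; norm_num
      _ ≤ ((21 / 19) ^ 9) ^ m := pow_le_pow_left₀ (by norm_num) (by norm_num) m
      _ = _ := by rw [← pow_mul, ← pow_mul, mul_comm]
  have h4 : 1 / ε < (21 / 19) ^ m := lt_of_pow_lt_pow_left₀ 9 (by positivity) (hpow.trans_le h2)
  have h5 : (19 / 21 : ℝ) ^ m = 1 / (21 / 19) ^ m := by
    rw [← one_div_pow]
    norm_num
  rw [h5, div_lt_iff₀ (by positivity)]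
  rwa [div_lt_iff₀ h0, mul_comm] at h4

end Numeric

theorem List.Forall₂.exists_of_mem_left {α β : Type*} {R : α → β → Prop} {l : List α}
    {l' : List β} (h : List.Forall₂ R l l') {a : α} (ha : a ∈ l) : ∃ b ∈ l', R a b := by
  induction h with
  | nil => simp at ha
  | cons hr _ ih =>
    rcases List.mem_cons.1 ha with rfl | ha
    · exact ⟨_, List.mem_cons_self, hr⟩
    · obtain ⟨b, hb, hab⟩ := ih ha
      exact ⟨b, List.mem_cons_of_mem _ hb, hab⟩

/-! ### Probability of error -/

section ErrorBound

variable {ι : Type} {x : ι → ℝ} {C : AdaptiveComparator x}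

open QueryAlg

theorem IsAnswer.eq_of_lt {i j w : ι} (hw : IsAnswer x (i, j) w) (hij : x j < x i - 1) :
    w = i := by
  have := hw.2 (by rw [abs_of_pos (by linarith)]; linarith)
  rwa [if_pos (by linarith)] at this

theorem IsAnswer.swap {i j w : ι} (hw : IsAnswer x (i, j) w) (hij : 1 < |x i - x j|) :
    IsAnswer x (j, i) w := by
  refine ⟨hw.1.symm, fun _ => (hw.2 hij).trans ?_⟩
  rcases lt_trichotomy (x i) (x j) with h | h | h
  · simp [h, h.le]
  · norm_num [h] at hij
  · simp [h, h.le]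

theorem IsAnswer.eq_of_lt' {i j w : ι} (hw : IsAnswer x (j, i) w) (hij : x j < x i - 1) :
    w = i :=
  (hw.swap (by rw [abs_sub_comm, abs_of_pos (by linarith)]; linarith)).eq_of_lt hij

/-- The items of `X` that are not surely beaten by `a`. -/
noncomputable def closeTo (x : ι → ℝ) (a : ι) (X : Finset ι) : Finset ι :=
  X.filter fun j => x a - 1 ≤ x j

theorem closeTo_subset_closeTo {a : ι} {X Y : Finset ι} (h : Y ⊆ X) :
    closeTo x a Y ⊆ closeTo x a X :=
  Finset.filter_subset_filter _ h

/-- All items of `Y` have a value of at least `x a - 2`. -/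
def AllNear (x : ι → ℝ) (a : ι) (Y : Finset ι) : Prop :=
  ∀ j ∈ Y, x a - 2 ≤ x j

/-- The item `a` wins in a knock-out unless its partner is an item of value close to `a`, or it has
no partner. -/
theorem koPairs_always (X : Finset ι) {a : ι} (ha : a ∈ X) (e : Fin X.card ≃ X)
    (hpa : x (e (partnerIdx (e.symm ⟨a, ha⟩))).1 < x a - 1) (h : History ι) :
    (playAll (List.ofFn fun k : Fin (X.card / 2) =>
      ((e ⟨2 * k.1, by omega⟩).1, (e ⟨2 * k.1 + 1, by omega⟩).1))).Always C
      (fun ws _ => a ∈ ws) h := by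
  refine (playAll_always _ h).mono fun ws _ hw => ?_
  set k := e.symm ⟨a, ha⟩ with hk
  have hek : (e k).1 = a := by rw [hk, Equiv.apply_symm_apply]
  have hne : partnerIdx k ≠ k := by
    intro hkk
    rw [hkk, hek] at hpa
    linarith
  have hkc := k.2
  have hval := partnerIdx_val k
  have hne' : (partnerIdx k).1 ≠ k.1 := fun h => hne (Fin.ext h)
  have hlt : k.1 / 2 < X.card / 2 := by
    split_ifs at hval <;> omega
  obtain ⟨w, hw, hans⟩ := hw.1.exists_of_mem_left (List.mem_ofFn.2 ⟨⟨k.1 / 2, hlt⟩, rfl⟩)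
  rcases Nat.mod_two_eq_zero_or_one k.1 with h2 | h2
  · have h3 : (⟨2 * (k.1 / 2), by omega⟩ : Fin X.card) = k := Fin.ext (by dsimp only; omega)
    have h4 : (⟨2 * (k.1 / 2) + 1, by omega⟩ : Fin X.card) = partnerIdx k := by
      refine Fin.ext ?_
      dsimp only
      split_ifs at hval <;> omega
    simp only [h3, h4, hek] at hans
    rwa [hans.eq_of_lt hpa] at hw
  · have h3 : (⟨2 * (k.1 / 2) + 1, by omega⟩ : Fin X.card) = k := Fin.ext (by dsimp only; omega)
    have h4 : (⟨2 * (k.1 / 2), by omega⟩ : Fin X.card) = partnerIdx k := by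
      refine Fin.ext ?_
      dsimp only
      split_ifs at hval <;> omega
    simp only [h3, h4, hek] at hans
    rwa [hans.eq_of_lt' hpa] at hw

theorem card_filter_div_le {a : ι} {X : Finset ι} {N : ℕ} (hX : X.Nonempty) (hN : X.card ≤ N) :
    ((X.filter fun j => ¬ x a - 1 ≤ x j).card : ℝ≥0∞) * (X.card : ℝ≥0∞)⁻¹ ≤
      1 - ((closeTo x a X).card : ℝ≥0∞) / N := by
  have h0 : (X.card : ℝ≥0∞) ≠ 0 := by exact_mod_cast hX.card_ne_zero
  refine ENNReal.le_sub_of_add_le_right ?_ ?_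
  · refine ENNReal.div_ne_top (ENNReal.natCast_ne_top _) ?_
    exact_mod_cast (hX.card_pos.trans_le hN).ne'
  · calc _ ≤ ((X.filter fun j => ¬ x a - 1 ≤ x j).card : ℝ≥0∞) * (X.card : ℝ≥0∞)⁻¹ +
          (closeTo x a X).card * (X.card : ℝ≥0∞)⁻¹ := by
          rw [div_eq_mul_inv]
          gcongr
      _ = (X.card : ℝ≥0∞) * (X.card : ℝ≥0∞)⁻¹ := by
          rw [← add_mul, ← Nat.cast_add, add_comm, closeTo,
            Finset.card_filter_add_card_filter_not]
      _ ≤ 1 := (ENNReal.mul_inv_cancel h0 (ENNReal.natCast_ne_top _)).le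

variable [DecidableEq ι]

/-- The dichotomy of quick-select: an item beating a close pivot is at most 1 below it, whereas a
pivot that is not close surely loses to `a`. -/
theorem playAll_pivot_always (X : Finset ι) (a p : ι) (ha : a ∈ X) (h : History ι) :
    (playAll ((X.erase p).toList.map fun j => (p, j))).Always C (fun ws _ =>
      (x a - 1 ≤ x p → AllNear x a ((X.erase p).filter fun j => j ∈ ws)) ∧
      (x p < x a - 1 → a ∈ (X.erase p).filter fun j => j ∈ ws)) h := by
  refine (playAll_always _ h).mono fun ws _ hw => ⟨fun hp j hj => ?_, fun hp => ?_⟩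
  · obtain ⟨hjX, hjw⟩ := Finset.mem_filter.1 hj
    obtain ⟨⟨i, k⟩, hik, hans⟩ := hw.1.flip.exists_of_mem_left hjw
    obtain ⟨k', _, hk'⟩ := List.mem_map.1 hik
    obtain ⟨rfl, rfl⟩ := Prod.mk.inj hk'
    have hjp : j ≠ p := Finset.ne_of_mem_erase hjX
    obtain rfl : j = k' := hans.1.resolve_left hjp
    by_contra hlt
    exact hjp (IsAnswer.eq_of_lt hans (by linarith))
  · have hap : a ∈ X.erase p := by
      refine Finset.mem_erase.2 ⟨?_, ha⟩
      rintro rfl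
      linarith
    obtain ⟨w, hw, hans⟩ := hw.1.exists_of_mem_left
      (List.mem_map.2 ⟨a, Finset.mem_toList.2 hap, rfl⟩)
    rw [hans.eq_of_lt' hp] at hw
    exact Finset.mem_filter.2 ⟨hap, hw⟩

theorem qsSub_expect_le {a : ι} {X : Finset ι} (hX : X.Nonempty) (ha : a ∈ X) {N : ℕ}
    (hN : X.card ≤ N) (g : Remaining X → History ι → ℝ≥0∞) (B : ℝ≥0∞)
    (hnear : ∀ Y h', AllNear x a Y.1 → g Y h' = 0) (hB : ∀ Y h', a ∈ Y.1 → g Y h' ≤ B)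
    (h : History ι) :
    (qsSub X hX).expect C g h ≤ (1 - ((closeTo x a X).card : ℝ≥0∞) / N) * B := by
  have hpiv : (qsSub X hX).expect C g h ≤
      ∑ p : X, (X.card : ℝ≥0∞)⁻¹ * (if ¬ x a - 1 ≤ x p.1 then B else 0) := by
    have : Nonempty X := hX.to_subtype
    rw [qsSub, expect_bind, expect_draw, tsum_fintype]
    refine Finset.sum_le_sum fun p _ => ?_
    rw [PMF.uniformOfFintype_apply, Fintype.card_coe, expect_bind]
    refine mul_le_mul_right ((playAll_pivot_always X a p.1 ha h).expect_le fun ws h' hws => ?_) _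
    dsimp only
    by_cases hp : x a - 1 ≤ x p.1
    · rw [if_neg (not_not.2 hp)]
      split_ifs with hY
      · exact (hnear _ _ (hws.1 hp)).le
      · refine (hnear _ _ fun j hj => ?_).le
        rw [Finset.mem_singleton.1 hj]
        linarith
    · rw [if_pos hp]
      have haY := hws.2 (not_le.1 hp)
      rw [dif_pos ⟨a, haY⟩]
      exact hB _ _ haY
  refine hpiv.trans ?_
  rw [Finset.sum_coe_sort X fun p =>
    (X.card : ℝ≥0∞)⁻¹ * (if ¬ x a - 1 ≤ x p then B else 0), ← Finset.mul_sum, ← Finset.sum_filter,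
    Finset.sum_const, nsmul_eq_mul, mul_left_comm, ← mul_assoc]
  exact mul_le_mul_left (card_filter_div_le hX hN) B

/-- The final set `Y` depends on the adversary, so the survival factor is charged to each outcome.
Close sets only shrink, hence every call fails with probability at most `1 - s/N` for the final
number `s` of close items. -/
theorem qsRepeat_expect_le {a : ι} {N m : ℕ} {W : ℝ≥0∞} {X : Finset ι} (hX : X.Nonempty)
    (ha : a ∈ X) (hN : X.card ≤ N)
    (g : {Y : Finset ι // Y.Nonempty ∧ Y ⊆ X ∧ (0 < m → 1 < X.card → Y.card < X.card)} →
      History ι → ℝ≥0∞)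
    (hnear : ∀ Y h', AllNear x a Y.1 → g Y h' = 0)
    (hW : ∀ Y h', a ∈ Y.1 → g Y h' * (1 - ((closeTo x a Y.1).card : ℝ≥0∞) / N) ^ m ≤ W)
    (h : History ι) : (qsRepeat m X hX).expect C g h ≤ W := by
  induction m generalizing X W h with
  | zero => simpa [qsRepeat] using hW ⟨X, hX, subset_rfl, fun h => absurd h (lt_irrefl 0)⟩ h ha
  | succ m ih =>
    set c : ℝ≥0∞ := 1 - ((closeTo x a X).card : ℝ≥0∞) / N with hc
    have hcT : c ≠ ⊤ := ENNReal.sub_ne_top ENNReal.one_ne_top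
    rw [qsRepeat, expect_bind]
    -- The first call contributes the factor `c`, so the remaining calls may cost `W / c`; for `c =
    -- 0` any bound will do, since `0 * ⊤ = 0`.
    refine (qsSub_expect_le hX ha hN _ (if c = 0 then ⊤ else W / c) ?_ ?_ h).trans ?_
    · refine fun Y h' hY => le_antisymm ?_ zero_le
      rw [expect_bind]
      exact expect_le_of_forall _ (fun Z h'' => (hnear _ _ fun j hj => hY j (Z.2.2.1 hj)).le) _
    · intro Y h' haY
      split_ifs with hc0
      · exact le_top
      · rw [expect_bind]
        refine ih Y.2.1 haY ((Finset.card_le_card Y.2.2.1).trans hN) _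
          (fun Z h'' hZ => hnear _ _ hZ) (fun Z h'' haZ => ?_) h'
        rw [ENNReal.le_div_iff_mul_le (Or.inl hc0) (Or.inl hcT), mul_assoc]
        refine le_trans ?_ (hW ⟨Z.1, Z.2.1, Z.2.2.1.trans Y.2.2.1, fun _ h =>
          (Finset.card_le_card Z.2.2.1).trans_lt (Y.2.2.2 h)⟩ h'' haZ)
        rw [pow_succ]
        have hcZ : c ≤ 1 - ((closeTo x a Z.1).card : ℝ≥0∞) / N := by
          refine tsub_le_tsub_left (ENNReal.div_le_div_right ?_ _) 1
          exact_mod_cast Finset.card_le_card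
            (closeTo_subset_closeTo (Z.2.2.1.trans Y.2.2.1))
        exact mul_le_mul_right (mul_le_mul_right hcZ _) _
    · split_ifs with hc0
      · simp [← hc, hc0]
      · exact ENNReal.mul_div_le

theorem koSub_expect_le {X : Finset ι} {a : ι} (ha : a ∈ X) (h : History ι) :
    (koSub X).expect C (fun W _ => if a ∈ W then 0 else 1) h ≤
      ((closeTo x a X).card : ℝ≥0∞) / X.card := by
  have : Nonempty (Fin X.card ≃ X) := ⟨X.equivFin.symm⟩
  set S : Finset X := Finset.univ.filter fun b => x a - 1 ≤ x b.1 with hS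
  have hScard : S.card = (closeTo x a X).card := by
    rw [hS, closeTo, Finset.card_filter, Finset.card_filter,
      Finset.sum_coe_sort X fun b => if x a - 1 ≤ x b then 1 else 0]
  have haS : (⟨a, ha⟩ : X) ∈ S := by simp [hS]
  set M := Fintype.card (Fin X.card ≃ X) with hM
  set F := Finset.univ.filter fun e : Fin X.card ≃ X =>
    e (partnerIdx (e.symm ⟨a, ha⟩)) ∈ S with hF
  have hcount : F.card * X.card ≤ S.card * M := by
    have := card_partner_mem_mul_le (partnerIdx_involutive X.card)
      (fun k l => eq_of_partnerIdx_eq_self) ⟨a, ha⟩ S haS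
    rwa [Fintype.card_coe] at this
  have hM0 : (M : ℝ≥0∞) ≠ 0 := by exact_mod_cast Fintype.card_ne_zero
  have hX0 : (X.card : ℝ≥0∞) ≠ 0 := by exact_mod_cast (Finset.card_pos.2 ⟨a, ha⟩).ne'
  have hle : (koSub X).expect C (fun W _ => if a ∈ W then 0 else 1) h ≤
      ∑ e : Fin X.card ≃ X, (M : ℝ≥0∞)⁻¹ *
        (if e (partnerIdx (e.symm ⟨a, ha⟩)) ∈ S then 1 else 0) := by
    rw [koSub, expect_bind, expect_draw, tsum_fintype]
    refine Finset.sum_le_sum fun e _ => ?_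
    rw [PMF.uniformOfFintype_apply, expect_bind]
    refine mul_le_mul_right ?_ _
    split_ifs with he
    · refine expect_le_of_forall _ (fun ws h' => ?_) h
      rw [expect_pure]
      split_ifs <;> simp
    · refine (koPairs_always X ha e ?_ h).expect_le fun ws h' hws => ?_
      · simpa [hS, -tsub_le_iff_right] using he
      · rw [expect_pure, if_pos (List.mem_toFinset.2 hws)]
  refine hle.trans ?_
  rw [← Finset.mul_sum, ← Finset.sum_filter, Finset.sum_const, nsmul_eq_mul, mul_one, ← hScard,
    ENNReal.le_div_iff_mul_le (Or.inl hX0) (Or.inl (ENNReal.natCast_ne_top _)), mul_assoc,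
    ENNReal.inv_mul_le_iff hM0 (ENNReal.natCast_ne_top _), mul_comm (M : ℝ≥0∞)]
  exact_mod_cast hcount

/-- An exponential moment of the number of games not won: conditionally on the past, each knock-out
multiplies it by at most `1 + u · s/|X|`. -/
theorem koRepeat_expect_pow_le {X : Finset ι} {a : ι} (ha : a ∈ X) (u : ℝ≥0∞) (t : ℕ)
    (h : History ι) : (koRepeat X t).expect C (fun c _ => (1 + u) ^ (t - c a)) h ≤
      (1 + u * (((closeTo x a X).card : ℝ≥0∞) / X.card)) ^ t := by
  induction t with
  | zero => simp [koRepeat]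
  | succ t ih =>
    rw [koRepeat, expect_bind, pow_succ]
    calc _ ≤ (koRepeat X t).expect C (fun c _ =>
          (1 + u * (((closeTo x a X).card : ℝ≥0∞) / X.card)) * (1 + u) ^ (t - c a)) h := by
          refine expect_mono _ (fun c h' => ?_) h
          rw [expect_bind, mul_comm]
          calc _ ≤ (koSub X).expect C (fun W _ =>
                (1 + u) ^ (t - c a) * (1 + u * if a ∈ W then 0 else 1)) h' := by
                refine expect_mono _ (fun W h'' => ?_) h'
                rw [expect_pure]
                dsimp only
                split_ifs
                · rw [Nat.add_sub_add_right, mul_zero, add_zero, mul_one]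
                · rw [mul_one, ← pow_succ, add_zero]
                  -- Truncated subtraction is harmless: only an upper bound on the exponent is
                  -- needed, so `c a ≤ t` need not be known.
                  exact pow_le_pow_right₀ le_self_add (by omega)
            _ ≤ _ := by
                rw [expect_mul_left, expect_add, expect_const, expect_mul_left]
                gcongr
                exact koSub_expect_le ha h'
      _ ≤ _ := by
          rw [expect_mul_left, mul_comm]
          exact mul_le_mul_left ih _

/-- The probability that `a` has at most `3 / 4` of the possible wins in `t` knock-outs. -/
noncomputable def koFailure (C : AdaptiveComparator x) (X : Finset ι) (t : ℕ) (a : ι)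
    (h : History ι) : ℝ≥0∞ :=
  (koRepeat X t).expect C (fun c _ => if (3 / 4 : ℝ) * t < c a then 0 else 1) h

theorem koFailure_le_one (X : Finset ι) (t : ℕ) (a : ι) (h : History ι) :
    koFailure C X t a h ≤ 1 :=
  expect_le_of_forall _ (fun c _ => by split_ifs <;> simp) h

/-- Markov's inequality with `u = y^4 - 1`: failure means at least `t/4` games not won, so the
moment is at least `y^t` there and at least 1 elsewhere. Keeping this 1 lets the bound on the
failure probability vanish with the fraction of close items. -/
theorem koFailure_mul_add_one_le {X : Finset ι} {a : ι} (ha : a ∈ X) (t : ℕ) (h : History ι)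
    {y : ℝ} (hy : 1 ≤ y) :
    (koFailure C X t a h).toReal * (y ^ t - 1) + 1 ≤
      (1 + (y ^ 4 - 1) * ((closeTo x a X).card / X.card)) ^ t := by
  have hy4 : 0 ≤ y ^ 4 - 1 := sub_nonneg.2 (one_le_pow₀ hy)
  have hyt : 0 ≤ y ^ t - 1 := sub_nonneg.2 (one_le_pow₀ hy)
  have hX0 : (X.card : ℝ≥0∞) ≠ 0 := by exact_mod_cast (Finset.card_pos.2 ⟨a, ha⟩).ne'
  have hmarkov : ENNReal.ofReal (y ^ t - 1) * koFailure C X t a h + 1 ≤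
      (1 + ENNReal.ofReal (y ^ 4 - 1) * (((closeTo x a X).card : ℝ≥0∞) / X.card)) ^ t := by
    refine le_trans ?_ (koRepeat_expect_pow_le (C := C) ha _ t h)
    rw [koFailure, ← expect_mul_left,
      ← expect_const (C := C) (koRepeat X t) 1 h, ← expect_add, expect_const]
    refine expect_mono _ (fun c h' => ?_) h
    split_ifs with hc
    · rw [mul_zero, zero_add]
      exact one_le_pow₀ le_self_add
    · have h4 : 4 * c a ≤ 3 * t := by
        rw [not_lt] at hc
        have : (4 : ℝ) * c a ≤ 3 * t := by linarith
        exact_mod_cast this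
      rw [mul_one, ← ENNReal.ofReal_one, ← ENNReal.ofReal_add hyt zero_le_one,
        ← ENNReal.ofReal_add zero_le_one hy4, ← ENNReal.ofReal_pow (by linarith)]
      refine ENNReal.ofReal_le_ofReal ?_
      rw [sub_add_cancel, add_sub_cancel, ← pow_mul]
      exact pow_le_pow_right₀ hy (by omega)
  have hfin : koFailure C X t a h ≠ ⊤ :=
    ((koFailure_le_one X t a h).trans_lt ENNReal.one_lt_top).ne
  have hdiv : ((closeTo x a X).card : ℝ≥0∞) / X.card ≠ ⊤ :=
    ENNReal.div_ne_top (ENNReal.natCast_ne_top _) hX0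
  have hmul := ENNReal.mul_ne_top (ENNReal.ofReal_ne_top (r := y ^ 4 - 1)) hdiv
  have := ENNReal.toReal_mono
    (ENNReal.pow_ne_top (ENNReal.add_ne_top.2 ⟨ENNReal.one_ne_top, hmul⟩)) hmarkov
  rw [ENNReal.toReal_add (ENNReal.mul_ne_top ENNReal.ofReal_ne_top hfin) ENNReal.one_ne_top,
    ENNReal.toReal_pow, ENNReal.toReal_add ENNReal.one_ne_top hmul, ENNReal.toReal_mul,
    ENNReal.toReal_mul, ENNReal.toReal_ofReal hyt, ENNReal.toReal_ofReal hy4, ENNReal.toReal_div,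
    ENNReal.toReal_natCast, ENNReal.toReal_natCast, ENNReal.toReal_one] at this
  rwa [mul_comm] at this

/-! ### The error invariant through rounds -/

theorem combRound_expect_le {ε : ℝ} (h0 : 0 < ε) (h1 : ε < 1 / 2) {i : ℕ} (hi : 1 ≤ i) {a : ι}
    {X : Finset ι} (hX : 1 < X.card) (ha : a ∈ X)
    (g : {Y : Finset ι // Y.Nonempty ∧ Y.card < X.card} → History ι → ℝ≥0∞)
    (hg1 : ∀ Y h', g Y h' ≤ 1) (hnear : ∀ Y h', AllNear x a Y.1 → g Y h' = 0)
    (hW : ∀ Y h', a ∈ Y.1 → g Y h' ≤ ENNReal.ofReal ((19 / 21) ^ qsCalls ε)) (h : History ι) :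
    (combRound ε h0 h1 i X hX).expect C g h ≤ ENNReal.ofReal ((19 / 21) ^ qsCalls ε) := by
  set w : ℝ := (19 / 21) ^ qsCalls ε with hw
  have hw0 : 0 ≤ w := by positivity
  have hw1 : w ≤ 1 := pow_le_one₀ (by norm_num) (by norm_num)
  rw [combRound, expect_bind]
  refine qsRepeat_expect_le (N := X.card) (a := a) _ ha le_rfl _ ?_ ?_ h
  · intro Y h₁ hY
    refine le_antisymm ?_ zero_le
    dsimp only
    split_ifs with hc
    · rw [expect_bind]
      refine expect_le_of_forall _ (fun c h₂ => ?_) h₁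
      split_ifs with hZ
      · exact (hnear _ _ fun j hj => hY j (Finset.mem_filter.1 hj).1).le
      · refine (hnear _ _ fun j hj => hY j ?_).le
        rw [Finset.mem_singleton.1 hj]
        exact (Y.1.exists_max_image c Y.2.1).choose_spec.1
    · exact (hnear _ _ hY).le
  · intro Y h₁ haY
    dsimp only
    split_ifs with hc
    · have hX0 : (0 : ℝ) < X.card := by exact_mod_cast zero_lt_one.trans hX
      have hY0 : (0 : ℝ) < Y.1.card := by exact_mod_cast Finset.card_pos.2 ⟨a, haY⟩
      set p := (koFailure C Y.1 (koCalls ε i) a h₁).toReal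
      have hfin : koFailure C Y.1 (koCalls ε i) a h₁ ≠ ⊤ :=
        ((koFailure_le_one Y.1 (koCalls ε i) a h₁).trans_lt ENNReal.one_lt_top).ne
      have hp1 : p ≤ 1 := by
        simpa using ENNReal.toReal_mono ENNReal.one_ne_top
          (koFailure_le_one (C := C) Y.1 (koCalls ε i) a h₁)
      set s : ℝ := ((closeTo x a Y.1).card : ℝ) with hs
      have hs0 : 0 ≤ s := Nat.cast_nonneg _
      have hsX : s ≤ X.card := by
        exact Nat.cast_le.2 (Finset.card_le_card ((Finset.filter_subset _ _).trans Y.2.2.1))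
      -- Knock-out is run only if `|Y| > 2|X|/3`, which gives `2/3 · s/|Y| ≤ s/|X|`.
      have hround := round_error_le (m := qsCalls ε) (t := koCalls ε i) (f := s / Y.1.card)
        (b := s / X.card) (qsCalls_pos h0 h1) (three_mul_qsCalls_le_koCalls h0 h1 hi)
        (by positivity)
        (by
          rw [mul_div_assoc', div_le_div_iff₀ hY0 hX0]
          nlinarith)
        ((div_le_one hX0).2 hsX) hp1
        (koFailure_mul_add_one_le haY (koCalls ε i) h₁ (by norm_num))
      have hpow : (1 - ((closeTo x a Y.1).card : ℝ≥0∞) / X.card) ^ qsCalls ε =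
          ENNReal.ofReal ((1 - s / X.card) ^ qsCalls ε) := by
        rw [ENNReal.ofReal_pow (sub_nonneg.2 ((div_le_one hX0).2 hsX)),
          ENNReal.ofReal_sub _ (by positivity), ENNReal.ofReal_one, ENNReal.ofReal_div_of_pos hX0,
          hs, ENNReal.ofReal_natCast, ENNReal.ofReal_natCast]
      rw [hpow]
      -- If `a` gets enough wins the later error is at most `w`; otherwise it is bounded by `1 = w +
      -- (1 - w)`.
      refine le_trans (mul_le_mul' (b := ENNReal.ofReal (w + (1 - w) * p)) ?_ le_rfl) ?_
      · rw [expect_bind, ENNReal.ofReal_add hw0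
          (mul_nonneg (sub_nonneg.2 hw1) ENNReal.toReal_nonneg),
          ENNReal.ofReal_mul (sub_nonneg.2 hw1), ENNReal.ofReal_toReal hfin, koFailure,
          ← expect_mul_left,
          ← expect_const (C := C) (koRepeat Y.1 (koCalls ε i)) (ENNReal.ofReal w) h₁,
          ← expect_add]
        refine expect_mono _ (fun c h₂ => ?_) h₁
        split_ifs with hZ hac hac
        · rw [mul_zero, add_zero, expect_pure]
          exact hW _ _ (Finset.mem_filter.2 ⟨haY, hac⟩)
        · rw [mul_one, ← ENNReal.ofReal_add hw0 (sub_nonneg.2 hw1), add_sub_cancel,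
            ENNReal.ofReal_one, expect_pure]
          exact hg1 _ _
        · exact absurd ⟨a, Finset.mem_filter.2 ⟨haY, hac⟩⟩ hZ
        · rw [mul_one, ← ENNReal.ofReal_add hw0 (sub_nonneg.2 hw1), add_sub_cancel,
            ENNReal.ofReal_one, expect_pure]
          exact hg1 _ _
      · rw [← ENNReal.ofReal_mul (add_nonneg hw0
          (mul_nonneg (sub_nonneg.2 hw1) ENNReal.toReal_nonneg))]
        exact ENNReal.ofReal_le_ofReal hround
    · rw [expect_pure]
      exact (mul_le_of_le_one_right' (pow_le_one' tsub_le_self _)).trans (hW _ _ haY)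

/-- Both claims go through one induction on the size of the set, because a round containing `a` may
end in a near set without `a`. -/
theorem combLoop_expect_le {ε : ℝ} (h0 : 0 < ε) (h1 : ε < 1 / 2) {i : ℕ} (hi : 1 ≤ i) {a : ι}
    {X : Finset ι} (hX : X.Nonempty) (h : History ι) :
    (AllNear x a X → (combLoop ε h0 h1 i X hX).expect C
      (fun r _ => if x r < x a - 2 then 1 else 0) h = 0) ∧
    (a ∈ X → (combLoop ε h0 h1 i X hX).expect C
      (fun r _ => if x r < x a - 2 then 1 else 0) h ≤
        ENNReal.ofReal ((19 / 21) ^ qsCalls ε)) := by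
  induction hc : X.card using Nat.strong_induction_on generalizing X i h with
  | _ N ih =>
    subst hc
    rw [combLoop]
    split_ifs with hX1
    · rw [expect_bind]
      constructor
      · intro hXn
        refine le_antisymm ((combRound_always_subset ε h0 h1 i X hX1 h).expect_le
          fun Y h' hY => ?_) zero_le
        exact ((ih _ Y.2.2 (by omega) Y.2.1 h' rfl).1 fun j hj => hXn j (hY hj)).le
      · intro ha
        refine combRound_expect_le h0 h1 hi hX1 ha _ (fun Y h' => ?_)
          (fun Y h' hY => (ih _ Y.2.2 (by omega) Y.2.1 h' rfl).1 hY)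
          (fun Y h' haY => (ih _ Y.2.2 (by omega) Y.2.1 h' rfl).2 haY) h
        exact expect_le_of_forall _ (fun r _ => by split_ifs <;> simp) h'
    · rw [expect_pure]
      constructor
      · intro hXn
        exact if_neg (not_lt.2 (hXn _ hX.choose_spec))
      · intro ha
        have : hX.choose = a := Finset.card_le_one.1 (not_lt.1 hX1) _ hX.choose_spec _ ha
        rw [this, if_neg (by linarith)]
        exact zero_le

end ErrorBound

/-! ### Conclusion -/

theorem combAlg_approxError_le (n : ℕ) [NeZero n] (ε : ℝ) (h0 : 0 < ε) (h1 : ε < 1 / 2)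
    {x : Fin n → ℝ} (C : AdaptiveComparator x) :
    (combAlg n ε h0 h1).approxError C 2 ≤ ENNReal.ofReal ((19 / 21) ^ qsCalls ε) := by
  obtain ⟨a, _, ha⟩ := Finset.exists_mem_eq_sup' (Finset.univ_nonempty (α := Fin n)) x
  rw [QueryAlg.approxError_eq_expect, ha]
  exact (combLoop_expect_le h0 h1 le_rfl Finset.univ_nonempty []).2 (Finset.mem_univ a)

theorem combAlg_expectedQueries_le (n : ℕ) [NeZero n] (ε : ℝ) (h0 : 0 < ε) (h1 : ε < 1 / 2)
    {x : Fin n → ℝ} (C : AdaptiveComparator x) :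
    (combAlg n ε h0 h1).expectedQueries C ≤
      ENNReal.ofReal (177 * (n * Real.logb 2 (1 / ε))) := by
  rw [QueryAlg.expectedQueries,
    QueryAlg.tsum_run_mul _ (fun _ h' => ((h' : History (Fin n)).length : ℝ≥0∞))]
  refine (combAlg_always_length n ε h0 h1 C).expect_le fun _ h' hh => ?_
  rw [← ENNReal.ofReal_natCast]
  exact ENNReal.ofReal_le_ofReal hh

theorem mainTheorem1 :
    (∃ K : ℝ, 0 < K ∧ ∀ (n : ℕ) [NeZero n] (ε : ℝ) (h0 : 0 < ε) (h1 : ε < 1 / 2),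
      (combAlg n ε h0 h1).maxExpectedQueries ≤ ENNReal.ofReal (K * (n * Real.logb 2 (1 / ε))) ∧
      ∀ (x : Fin n → ℝ) (C : AdaptiveComparator x),
        ∀ r ∈ ((combAlg n ε h0 h1).run C []).support,
          (r.2.length : ℝ) ≤ K * (n * Real.logb 2 (1 / ε))) ∧
    ∀ (n : ℕ) [NeZero n] (ε : ℝ) (h0 : 0 < ε) (h1 : ε < 1 / 2),
      (combAlg n ε h0 h1).maxApproxError 2 < ENNReal.ofReal ε := by
  refine ⟨⟨177, by norm_num, fun n _ ε h0 h1 => ⟨?_, fun x C r hr => ?_⟩⟩, fun n _ ε h0 h1 => ?_⟩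
  · exact iSup₂_le fun x C => combAlg_expectedQueries_le n ε h0 h1 C
  · exact (combAlg_always_length n ε h0 h1 C).of_mem_support hr
  · exact (iSup₂_le fun x C => combAlg_approxError_le n ε h0 h1 C).trans_lt
      ((ENNReal.ofReal_lt_ofReal_iff h0).2 (pow_qsCalls_lt h0 h1))
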